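/- Let $j\ge 1$ be an integer and $p=2j/(2j-1)$, so that $p'=2j$. Work on the circle $\mathbb R/2\pi\mathbb Z$ with the measure $d\theta/2\pi$, with Fourier coefficients $\hat h(n)=\int_{-\pi}^{\pi}h(\theta)e^{-in\theta}\,d\theta/2\pi$ for $n\in\mathbb Z$, and identify functions that agree almost everywhere. Let $f$ be a complex-valued function in $L^p$, and put $g=|f|^{p-1}\operatorname{sgn}(f)$, where $\operatorname{sgn}(z)=z/|z|$ for $z\ne 0$ and $\operatorname{sgn}(0)=0$. Let $PD^{2j}$ be the set of $G\in L^{2j}$ with $\hat G(n)\ge 0$ for all $n$ (that is, $\hat G(n)$ is real and nonnegative), and let $PD^{2j}_{(g,f)}$ be the set of those $G\in PD^{2j}$ for which $\hat G(n)=0$ whenever $\hat f(n)=0$, and $\|G\|_{2j}=\|g\|_{2j}$. For $G\in PD^{2j}$ put $\Phi_f(G)=\sum_{n\in\mathbb Z}|\hat f(n)|\,\hat G(n)$. Then $g\in L^{2j}$, and the series $\Phi_f(G)$ converges for every $G\in PD^{2j}$. There is a unique function $G\in PD^{2j}_{(g,f)}$ for which $\Phi_f(G)$ is maximal in $PD^{2j}_{(g,f)}$.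 For this $G$, the product $F:=(G\overline G)^{j-1}G$ lies in $L^p$, satisfies $\|F\|_p=\|f\|_p$, and majorizes $f$: for every $n\in\mathbb Z$, $\hat F(n)$ is real and $\hat F(n)\ge|\hat f(n)|$. -/

import Mathlib

noncomputable section

namespace LowerMajorant

open MeasureTheory AddCircle
open scoped ENNReal Real ComplexOrder ComplexConjugate

instance twoPiPos : Fact (0 < 2 * π) := ⟨Real.two_pi_pos⟩

/-- The circle `ℝ / 2πℤ`; it carries the measure `dθ/2π`, which is `haarAddCircle`. -/
abbrev Circ : Type := AddCircle (2 * π)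

/-- The measure `dθ/2π` on the circle. -/
abbrev circMeasure : Measure Circ := haarAddCircle

/-- The complex space `L^q` of the circle (functions modulo equality almost everywhere). -/
abbrev LpCirc (q : ℝ≥0∞) : Type := Lp ℂ q circMeasure

/-- The exponent `p = 2j/(2j-1)`, as a real number. -/
def specialExp (j : ℕ) : ℝ := 2 * (j : ℝ) / (2 * (j : ℝ) - 1)

/-- The exponent `p' = 2j`, the conjugate of `specialExp j`. -/
def evenExp (j : ℕ) : ℝ≥0∞ := 2 * (j : ℝ≥0∞)

/-- The complex signum: `z / |z|` for `z ≠ 0`, and `0` for `z = 0`. -/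
def csgn (z : ℂ) : ℂ := z / (‖z‖ : ℂ)

/-- The function `|f|^{p-1} sgn(f)`. -/
def dualFun (p : ℝ) (f : Circ → ℂ) : Circ → ℂ :=
  fun t => ((‖f t‖ ^ (p - 1) : ℝ) : ℂ) * csgn (f t)

/-- `F` majorizes `f`: each `F̂(n)` is real and at least `|f̂(n)|`. (In the order of `ℂ`
used here, `z ≤ w` means that `w - z` is a nonnegative real number.) -/
def Majorizes (F f : Circ → ℂ) : Prop :=
  ∀ n : ℤ, ((‖fourierCoeff f n‖ : ℝ) : ℂ) ≤ fourierCoeff F n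

/-- The functions in `L^{2j}` all of whose Fourier coefficients are real and nonnegative. -/
def PD (j : ℕ) : Set (LpCirc (evenExp j)) :=
  {G | ∀ n : ℤ, 0 ≤ fourierCoeff G n}

/-- The members of `PD j` whose coefficients vanish off the support of `f̂`. -/
def PDsupp (j : ℕ) (f : Circ → ℂ) : Set (LpCirc (evenExp j)) :=
  {G | G ∈ PD j ∧ ∀ n : ℤ, fourierCoeff f n = 0 → fourierCoeff G n = 0}

/-- The members of `PDsupp j f` with the same `L^{2j}` norm as `g`. -/
def PDnorm (j : ℕ) (g f : Circ → ℂ) : Set (LpCirc (evenExp j)) :=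
  {G | G ∈ PDsupp j f ∧
    eLpNorm G (evenExp j) circMeasure = eLpNorm g (evenExp j) circMeasure}

/-- The terms `|f̂(n)| Ĝ(n)`; on `PD j` the coefficients `Ĝ(n)` are real, so that passing to
their real parts loses nothing. -/
def phiTerm (f G : Circ → ℂ) (n : ℤ) : ℝ :=
  ‖fourierCoeff f n‖ * (fourierCoeff G n).re

/-- `Φ_f(G) = ∑ |f̂(n)| Ĝ(n)`. -/
def Phi (f G : Circ → ℂ) : ℝ := ∑' n : ℤ, phiTerm f G n

/-- `G` belongs to `PDnorm j g f`, and `Φ_f(G)` is maximal in that set. -/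
def IsMaximizer (j : ℕ) (g f : Circ → ℂ) (G : LpCirc (evenExp j)) : Prop :=
  G ∈ PDnorm j g f ∧ ∀ H ∈ PDnorm j g f, Phi f H ≤ Phi f G

/-- The product `(G Ḡ)^{j-1} G`. -/
def powProd (j : ℕ) (G : Circ → ℂ) : Circ → ℂ :=
  fun t => (G t * conj (G t)) ^ (j - 1) * G t

end LowerMajorant

end

open MeasureTheory LowerMajorant

/-!
# A lower majorant from an extremal problem

The Hardy–Littlewood upper majorant property of `L^{2j}` says that `|û| ≤ Û` implies
`‖u‖_{2j} ≤ ‖U‖_{2j}`. It holds because the coefficients of `u ^ j` and `U ^ j` are iterated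
convolutions, so that `U ^ j` majorizes `u ^ j`, and Parseval's identity turns
`‖u‖_{2j}^{2j}` into `∑ |(u ^ j)^|²` (`Majorizes.integral_norm_pow_le`).

Multiplying the coefficients of `G ∈ PD^{2j}` by unimodular numbers therefore does not increase
its norm, and pairing the result with `f` gives `Φ_f(G) ≤ ‖f‖_p ‖G‖_{2j}` (`sum_phiTerm_le`). So
`Φ_f` is finite, and by density of the trigonometric polynomials its tails are uniformly small on
bounded sets (`exists_Phi_le_sum_add`). Clarkson's inequality, elementary for an even exponent,
shows that near-maximizers of `Φ_f` on a sphere of the cone are close to each other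
(`norm_sub_pow_le`). Hence a maximizing sequence converges, and the maximizer is unique.

Let `G` be the maximizer, `c = ‖G‖_{2j}`, and `F = (G Ḡ)^{j-1} G`. All coefficients of `F` are
nonnegative, since `F` is a product of powers of `G` and `Ḡ`. If `f̂(n) ≠ 0`, adding a small
multiple of the `n`-th character to `G` cannot increase `Φ_f(G) / ‖G‖`. The derivative of
`‖G‖_{2j}^{2j}` in this direction is `2j F̂(n)`, so `c^{2j} |f̂(n)| ≤ Φ_f(G) F̂(n)`
(`norm_fourierCoeff_mul_le`). Finally `Φ_f(G) ≤ ‖f‖_p c = c^{2j}`, because the norm of `G` is that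
of `|f|^{p-1} sgn f`.
-/

noncomputable section

namespace LowerMajorant

open MeasureTheory AddCircle Filter Topology
open scoped ENNReal Real ComplexOrder ComplexConjugate

/-! ### Fourier coefficients of products -/

lemma fourierCoeff_conj (u : Circ → ℂ) (n : ℤ) :
    fourierCoeff (fun t => conj (u t)) n = conj (fourierCoeff u (-n)) := by
  simp only [fourierCoeff, ← integral_conj, smul_eq_mul, map_mul, ← fourier_neg, neg_neg]

lemma fourierCoeff_fourier_mul (u : Circ → ℂ) (k n : ℤ) :
    fourierCoeff (fun t => fourier k t * u t) n = fourierCoeff u (n - k) := by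
  simp only [fourierCoeff, smul_eq_mul, ← mul_assoc, ← fourier_add]
  congr! 5
  ring

lemma memLp_fourier_mul {u : Circ → ℂ} {q : ℝ≥0∞} (hu : MemLp u q circMeasure) (k : ℤ) :
    MemLp (fun t => fourier k t * u t) q circMeasure := by
  refine hu.congr_norm ((map_continuous (fourier k)).aestronglyMeasurable.mul hu.1) ?_
  exact ae_of_all _ fun t => by simp [Circle.norm_coe]

lemma memLp_conj {u : Circ → ℂ} {q : ℝ≥0∞} (hu : MemLp u q circMeasure) :
    MemLp (fun t => conj (u t)) q circMeasure :=
  hu.congr_norm (Complex.continuous_conj.comp_aestronglyMeasurable hu.1)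
    (ae_of_all _ fun t => by simp)

/-- The Fourier coefficients of a product of two square-integrable functions are the convolution
of their coefficients: this is Parseval's identity for `conj u` times a character. -/
lemma hasSum_fourierCoeff_mul {u v : Circ → ℂ} (hu : MemLp u 2 circMeasure)
    (hv : MemLp v 2 circMeasure) (n : ℤ) :
    HasSum (fun m => fourierCoeff u (n - m) * fourierCoeff v m)
      (fourierCoeff (fun t => u t * v t) n) := by
  have hx := memLp_fourier_mul (memLp_conj hu) n
  have key := fourierBasis.hasSum_inner_mul_inner (hx.toLp _) (hv.toLp _)
  convert! key using 1
  · ext m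
    rw [← HilbertBasis.repr_apply_apply, fourierBasis_repr, ← inner_conj_symm,
      ← HilbertBasis.repr_apply_apply, fourierBasis_repr,
      fourierCoeff_congr_ae hx.coeFn_toLp, fourierCoeff_congr_ae hv.coeFn_toLp,
      fourierCoeff_fourier_mul, fourierCoeff_conj, Complex.conj_conj, neg_sub]
  · rw [L2.inner_def]
    refine integral_congr_ae ?_
    filter_upwards [hx.coeFn_toLp, hv.coeFn_toLp] with t h1 h2
    rw [h1, h2, RCLike.inner_apply, map_mul, Complex.conj_conj, fourier_neg, smul_eq_mul]
    ring

/-! ### Majorization and products -/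

lemma majorizes_iff {F f : Circ → ℂ} :
    Majorizes F f ↔ ∃ a : ℤ → ℝ, ∀ n, fourierCoeff F n = a n ∧ ‖fourierCoeff f n‖ ≤ a n := by
  constructor
  · intro h
    refine ⟨fun n => (fourierCoeff F n).re, fun n => ?_⟩
    have := Complex.le_def.1 (h n)
    simp only [Complex.ofReal_re, Complex.ofReal_im] at this
    exact ⟨Complex.ext rfl this.2.symm, this.1⟩
  · rintro ⟨a, ha⟩ n
    rw [(ha n).1]
    exact Complex.real_le_real.2 (ha n).2

/-- Nonnegativity of the coefficients is self-majorization, so that closure of positive definite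
functions under products is a case of `Majorizes.mul`. -/
lemma majorizes_self_iff {F : Circ → ℂ} : Majorizes F F ↔ ∀ n, 0 ≤ fourierCoeff F n := by
  constructor
  · intro h n
    exact le_trans (Complex.zero_le_real.2 (norm_nonneg _)) (h n)
  · intro h n
    rw [← Complex.norm_of_nonneg' (h n)]
    simp

/-- Majorization is preserved under products of square-integrable functions. -/
lemma Majorizes.mul {U V u v : Circ → ℂ} (hU : MemLp U 2 circMeasure) (hV : MemLp V 2 circMeasure)
    (hu : MemLp u 2 circMeasure) (hv : MemLp v 2 circMeasure)
    (h1 : Majorizes U u) (h2 : Majorizes V v) :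
    Majorizes (fun t => U t * V t) (fun t => u t * v t) := by
  obtain ⟨a, ha⟩ := majorizes_iff.1 h1
  obtain ⟨b, hb⟩ := majorizes_iff.1 h2
  refine majorizes_iff.2 ⟨fun n => (fourierCoeff (fun t => U t * V t) n).re, fun n => ?_⟩
  have hs := hasSum_fourierCoeff_mul hU hV n
  simp only [(ha _).1, (hb _).1, ← Complex.ofReal_mul] at hs
  have hre := Complex.hasSum_re hs
  have him := Complex.hasSum_im hs
  simp only [Complex.ofReal_re, Complex.ofReal_im] at hre him
  refine ⟨Complex.ext rfl (him.unique hasSum_zero), ?_⟩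
  refine (hasSum_fourierCoeff_mul hu hv n).norm_le_of_bounded hre fun m => ?_
  rw [norm_mul]
  exact mul_le_mul (ha _).2 (hb _).2 (norm_nonneg _) ((norm_nonneg _).trans (ha _).2)

lemma Majorizes.conj {U u : Circ → ℂ} (h : Majorizes U u) :
    Majorizes (fun t => conj (U t)) (fun t => conj (u t)) := by
  obtain ⟨a, ha⟩ := majorizes_iff.1 h
  refine majorizes_iff.2 ⟨fun n => a (-n), fun n => ?_⟩
  rw [fourierCoeff_conj, fourierCoeff_conj, (ha _).1, Complex.conj_ofReal, RCLike.norm_conj]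
  exact ⟨rfl, (ha _).2⟩

lemma majorizes_one : Majorizes (fun _ => 1) (fun _ => 1) := by
  refine majorizes_self_iff.2 fun n => ?_
  have : (fun _ : Circ => (1 : ℂ)) = fourier 0 := by ext; simp
  rw [this, fourierCoeff_fourier]
  by_cases h : n = 0
  · subst h; simp
  · simp [h]

lemma evenExp_eq (j : ℕ) : evenExp j = ((2 * j : ℕ) : ℝ≥0∞) := by simp [evenExp]

lemma evenExp_ne_top (j : ℕ) : evenExp j ≠ ∞ := by
  rw [evenExp_eq]; exact ENNReal.natCast_ne_top _

lemma one_le_evenExp {j : ℕ} (hj : 1 ≤ j) : 1 ≤ evenExp j := by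
  rw [evenExp_eq]; exact_mod_cast (by omega : 1 ≤ 2 * j)

lemma integrable_norm_pow {j k : ℕ} (hk : k ≤ 2 * j) {u : Circ → ℂ}
    (hu : MemLp u (evenExp j) circMeasure) : Integrable (fun t => ‖u t‖ ^ k) circMeasure := by
  refine (hu.mono_exponent (p := k) ?_).integrable_norm_pow'
  rw [evenExp_eq]
  exact_mod_cast hk

lemma memLp_pow {j k : ℕ} (hk : k ≤ j) {u : Circ → ℂ} (hu : MemLp u (evenExp j) circMeasure) :
    MemLp (fun t => u t ^ k) 2 circMeasure := by
  refine (memLp_two_iff_integrable_sq_norm (hu.1.pow k)).2 ?_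
  simp only [Pi.pow_apply, norm_pow, ← pow_mul]
  exact integrable_norm_pow (by omega) hu

lemma Majorizes.pow {j k : ℕ} (hk : k ≤ j) {U u : Circ → ℂ} (hU : MemLp U (evenExp j) circMeasure)
    (hu : MemLp u (evenExp j) circMeasure) (h : Majorizes U u) :
    Majorizes (fun t => U t ^ k) (fun t => u t ^ k) := by
  induction k with
  | zero => simpa using majorizes_one
  | succ k ih =>
    have h1 : (1 : ℕ) ≤ j := by omega
    have hU1 : MemLp U 2 circMeasure := by simpa using memLp_pow h1 hU
    have hu1 : MemLp u 2 circMeasure := by simpa using memLp_pow h1 hu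
    simp only [pow_succ]
    exact (ih (by omega)).mul (memLp_pow (by omega) hU) hU1 (memLp_pow (by omega) hu) hu1 h

lemma hasSum_sq_norm_fourierCoeff {u : Circ → ℂ} (hu : MemLp u 2 circMeasure) :
    HasSum (fun n => ‖fourierCoeff u n‖ ^ 2) (∫ t, ‖u t‖ ^ 2 ∂circMeasure) := by
  have := hasSum_sq_fourierCoeff (hu.toLp u)
  rw [fourierCoeff_congr_ae hu.coeFn_toLp] at this
  convert! this using 1
  refine integral_congr_ae ?_
  filter_upwards [hu.coeFn_toLp] with t h
  rw [h]

/-- The upper majorant property of `L^{2j}`: compare the coefficients of the `j`-th powers and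
use Parseval's identity. -/
lemma Majorizes.integral_norm_pow_le {j : ℕ} {U u : Circ → ℂ}
    (hU : MemLp U (evenExp j) circMeasure) (hu : MemLp u (evenExp j) circMeasure)
    (h : Majorizes U u) :
    ∫ t, ‖u t‖ ^ (2 * j) ∂circMeasure ≤ ∫ t, ‖U t‖ ^ (2 * j) ∂circMeasure := by
  have hp := h.pow le_rfl hU hu
  obtain ⟨a, ha⟩ := majorizes_iff.1 hp
  have s1 := hasSum_sq_norm_fourierCoeff (memLp_pow le_rfl hu)
  have s2 := hasSum_sq_norm_fourierCoeff (memLp_pow le_rfl hU)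
  simp only [norm_pow, ← pow_mul, mul_comm j 2] at s1 s2
  refine hasSum_le (fun n => ?_) s1 s2
  refine pow_le_pow_left₀ (norm_nonneg _) ?_ 2
  rw [(ha n).1, Complex.norm_real]
  exact (ha n).2.trans (le_abs_self _)

/-! ### The exponents and the pairing of `L^p` with `L^{2j}` -/

section Exponents

lemma holderConjugate_specialExp {j : ℕ} (hj : 1 ≤ j) :
    (specialExp j).HolderConjugate (2 * j) := by
  have : (1 : ℝ) ≤ j := by exact_mod_cast hj
  rw [Real.holderConjugate_iff, specialExp, lt_div_iff₀ (by linarith)]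
  refine ⟨by linarith, ?_⟩
  field_simp
  ring

lemma evenExp_eq_ofReal (j : ℕ) : evenExp j = ENNReal.ofReal (2 * j) := by
  rw [evenExp, ENNReal.ofReal_mul zero_le_two, ENNReal.ofReal_natCast, ENNReal.ofReal_ofNat]

variable {j : ℕ} [hj : Fact (1 ≤ j)]

instance holderConjugate_evenExp :
    ENNReal.HolderConjugate (ENNReal.ofReal (specialExp j)) (evenExp j) := by
  rw [evenExp_eq_ofReal]
  exact (holderConjugate_specialExp hj.out).ennrealOfReal

instance fact_one_le_evenExp : Fact (1 ≤ evenExp j) := ⟨one_le_evenExp hj.out⟩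

instance fact_one_le_specialExp : Fact (1 ≤ ENNReal.ofReal (specialExp j)) :=
  ⟨ENNReal.one_le_ofReal.2 (holderConjugate_specialExp hj.out).lt.le⟩

end Exponents

section Pairing

variable {p q : ℝ≥0∞} [Fact (1 ≤ p)] [Fact (1 ≤ q)]

lemma integrable_Lp (G : LpCirc q) : Integrable G circMeasure := (Lp.memLp G).integrable Fact.out

lemma norm_fourierCoeff_le (G : LpCirc q) (n : ℤ) : ‖fourierCoeff G n‖ ≤ ‖G‖ := by
  rw [Lp.norm_def]
  refine (norm_integral_le_integral_norm _).trans ?_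
  simp only [norm_smul, fourier_apply, Circle.norm_coe, one_mul]
  rw [integral_norm_eq_lintegral_enorm (integrable_Lp G).1, ← eLpNorm_one_eq_lintegral_enorm]
  exact ENNReal.toReal_mono (Lp.eLpNorm_ne_top G)
    (eLpNorm_le_eLpNorm_of_exponent_le Fact.out (Lp.memLp G).1)

/-- The `n`-th Fourier coefficient as a continuous linear functional on `L^q`. -/
def coeffCLM (q : ℝ≥0∞) [Fact (1 ≤ q)] (n : ℤ) : LpCirc q →L[ℂ] ℂ :=
  LinearMap.mkContinuous
    { toFun := fun G => fourierCoeff G n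
      map_add' := fun G H => by
        rw [fourierCoeff_congr_ae (Lp.coeFn_add G H),
          fourierCoeff.add (integrable_Lp G) (integrable_Lp H), Pi.add_apply]
      map_smul' := fun c G => by
        rw [fourierCoeff_congr_ae (Lp.coeFn_smul c G), fourierCoeff.const_smul, RingHom.id_apply] }
    1 fun G => by rw [one_mul]; exact norm_fourierCoeff_le G n

@[simp]
lemma coeffCLM_apply (G : LpCirc q) (n : ℤ) : coeffCLM q n G = fourierCoeff G n := rfl

lemma coeffCLM_fourierLp (k n : ℤ) : coeffCLM q n (fourierLp q k) = if n = k then 1 else 0 := by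
  rw [coeffCLM_apply, fourierCoeff_congr_ae (coeFn_fourierLp q k), fourierCoeff_fourier,
    Pi.single_apply]

/-- The bilinear pairing `∫ f h` of conjugate Lebesgue spaces. -/
def pairing (p q : ℝ≥0∞) [Fact (1 ≤ p)] [Fact (1 ≤ q)] [ENNReal.HolderConjugate p q] :
    LpCirc p →L[ℂ] LpCirc q →L[ℂ] ℂ :=
  (ContinuousLinearMap.mul ℂ ℂ).lpPairing circMeasure p q

variable [ENNReal.HolderConjugate p q]

lemma pairing_eq_integral (f : LpCirc p) (h : LpCirc q) :
    pairing p q f h = ∫ t, f t * h t ∂circMeasure := by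
  simp [pairing, ContinuousLinearMap.lpPairing_eq_integral]

lemma norm_pairing_le (f : LpCirc p) (h : LpCirc q) : ‖pairing p q f h‖ ≤ ‖f‖ * ‖h‖ := by
  have h1 : pairing p q f h
      = L1.integral ((ContinuousLinearMap.mul ℂ ℂ).holder 1 f h : Lp ℂ 1 circMeasure) := by
    rw [pairing_eq_integral, L1.integral_eq_integral]
    exact (integral_congr_ae ((ContinuousLinearMap.mul ℂ ℂ).coeFn_holder f h)).symm
  rw [h1]
  refine (L1.norm_integral_le _).trans
    (((ContinuousLinearMap.mul ℂ ℂ).norm_holder_apply_apply_le f h).trans ?_)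
  rw [mul_assoc]
  exact mul_le_of_le_one_left (by positivity) (ContinuousLinearMap.opNorm_mul_le ℂ ℂ)

lemma pairing_fourierLp (f : LpCirc p) (n : ℤ) :
    pairing p q f (fourierLp q (-n)) = fourierCoeff f n := by
  rw [pairing_eq_integral, fourierCoeff]
  refine integral_congr_ae ?_
  filter_upwards [coeFn_fourierLp q (-n)] with t ht
  rw [ht, smul_eq_mul, mul_comm]

/-- If all Fourier coefficients of `f` vanish, then so does the functional it induces on the dual
Lebesgue space, by density of the trigonometric polynomials. -/
lemma pairing_eq_zero (hq : q ≠ ∞) {f : LpCirc p} (hf : ∀ n, fourierCoeff f n = 0)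
    (h : LpCirc q) : pairing p q f h = 0 := by
  have h1 : Submodule.span ℂ (Set.range (fourierLp q)) ≤ (pairing p q f).ker := by
    rw [Submodule.span_le]
    rintro _ ⟨n, rfl⟩
    have := pairing_fourierLp (q := q) f (-n)
    rw [neg_neg, hf] at this
    exact this
  have h2 := Submodule.topologicalClosure_minimal _ h1 (ContinuousLinearMap.isClosed_ker _)
  rw [span_fourierLp_closure_eq_top hq] at h2
  exact h2 (Submodule.mem_top : h ∈ ⊤)

/-- The trigonometric polynomials are dense in `L^p`, in the form used below: up to a small error,
`f` has finite spectrum. -/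
lemma exists_norm_sub_le_finite_spectrum (hp : p ≠ ∞) (f : LpCirc p) {ε : ℝ} (hε : 0 < ε) :
    ∃ h : LpCirc p, ‖f - h‖ ≤ ε ∧ ∃ S : Finset ℤ, ∀ n ∉ S, fourierCoeff h n = 0 := by
  have hf : f ∈
      closure (SetLike.coe (Submodule.span ℂ (Set.range (fourierLp (T := 2 * π) p)))) := by
    rw [← Submodule.topologicalClosure_coe, span_fourierLp_closure_eq_top hp]
    trivial
  obtain ⟨h, hh, hd⟩ := Metric.mem_closure_iff.1 hf ε hε
  refine ⟨h, by rw [← dist_eq_norm]; exact hd.le, ?_⟩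
  clear hd
  induction hh using Submodule.span_induction with
  | mem x hx =>
    obtain ⟨k, rfl⟩ := hx
    refine ⟨{k}, fun n hn => ?_⟩
    rw [← coeffCLM_apply, coeffCLM_fourierLp, if_neg (by simpa using hn)]
  | zero => exact ⟨∅, fun n _ => by rw [← coeffCLM_apply, map_zero]⟩
  | add x y _ _ hx hy =>
    obtain ⟨S, hS⟩ := hx
    obtain ⟨T, hT⟩ := hy
    refine ⟨S ∪ T, fun n hn => ?_⟩
    rw [Finset.notMem_union] at hn
    rw [← coeffCLM_apply, map_add, coeffCLM_apply, coeffCLM_apply, hS n hn.1, hT n hn.2, add_zero]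
  | smul c x _ hx =>
    obtain ⟨S, hS⟩ := hx
    refine ⟨S, fun n hn => ?_⟩
    rw [← coeffCLM_apply, map_smul, coeffCLM_apply, hS n hn, smul_zero]

end Pairing

/-! ### The norm of `L^{2j}` -/

section Norm

variable {j : ℕ} [hj : Fact (1 ≤ j)]

lemma norm_pow_eq_integral (G : LpCirc (evenExp j)) :
    ‖G‖ ^ (2 * j) = ∫ t, ‖G t‖ ^ (2 * j) ∂circMeasure := by
  have h0 : 2 * j ≠ 0 := by have := hj.out; omega
  have h1 : (evenExp j).toReal = ((2 * j : ℕ) : ℝ) := by rw [evenExp_eq, ENNReal.toReal_natCast]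
  have hI : 0 ≤ ∫ t, ‖G t‖ ^ (2 * j) ∂circMeasure := integral_nonneg fun t => by positivity
  rw [Lp.norm_def, MemLp.eLpNorm_eq_integral_rpow_norm
    (zero_lt_one.trans_le (one_le_evenExp hj.out)).ne' (evenExp_ne_top j) (Lp.memLp G), h1]
  simp only [Real.rpow_natCast]
  rw [ENNReal.toReal_ofReal (by positivity), Real.rpow_inv_natCast_pow hI h0]

/-- Clarkson's inequality for complex numbers and an even exponent. -/
lemma clarkson_complex {j : ℕ} (hj : j ≠ 0) (a b : ℂ) :
    2 * (‖a + b‖ ^ (2 * j) + ‖a - b‖ ^ (2 * j)) ≤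
      2 ^ (2 * j) * (‖a‖ ^ (2 * j) + ‖b‖ ^ (2 * j)) := by
  -- The parallelogram law, and superadditivity followed by convexity of `x ^ j`.
  have hpar : ‖a + b‖ ^ 2 + ‖a - b‖ ^ 2 = 2 * (‖a‖ ^ 2 + ‖b‖ ^ 2) := by
    have := parallelogram_law_with_norm ℂ a b
    simpa only [← sq] using this
  have h1 := pow_add_pow_le (sq_nonneg ‖a + b‖) (sq_nonneg ‖a - b‖) hj
  have h2 := add_pow_le (sq_nonneg ‖a‖) (sq_nonneg ‖b‖) j
  rw [hpar, mul_pow] at h1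
  simp only [pow_mul]
  calc 2 * ((‖a + b‖ ^ 2) ^ j + (‖a - b‖ ^ 2) ^ j)
      ≤ 2 * (2 ^ j * (2 ^ (j - 1) * ((‖a‖ ^ 2) ^ j + (‖b‖ ^ 2) ^ j))) := by 
        gcongr
        exact h1.trans (by gcongr)
    _ = (2 ^ 2) ^ j * ((‖a‖ ^ 2) ^ j + (‖b‖ ^ 2) ^ j) := by
      obtain ⟨k, rfl⟩ := Nat.exists_eq_succ_of_ne_zero hj
      rw [Nat.succ_eq_add_one, Nat.add_sub_cancel, sq (2 : ℝ), mul_pow]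
      ring

/-- Clarkson's inequality in `L^{2j}`; it is the source of uniform convexity. -/
lemma clarkson (G H : LpCirc (evenExp j)) :
    2 * (‖G + H‖ ^ (2 * j) + ‖G - H‖ ^ (2 * j)) ≤
      2 ^ (2 * j) * (‖G‖ ^ (2 * j) + ‖H‖ ^ (2 * j)) := by
  have hint (K : LpCirc (evenExp j)) := integrable_norm_pow (le_refl (2 * j)) (Lp.memLp K)
  simp only [norm_pow_eq_integral]
  rw [← integral_add (hint _) (hint _), ← integral_add (hint _) (hint _), ← integral_const_mul,
    ← integral_const_mul]
  refine integral_mono_ae (((hint _).add (hint _)).const_mul _)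
    (((hint _).add (hint _)).const_mul _) ?_
  filter_upwards [Lp.coeFn_add G H, Lp.coeFn_sub G H] with t h1 h2
  simp only [h1, h2, Pi.add_apply, Pi.sub_apply]
  exact clarkson_complex (by have := hj.out; omega) _ _

lemma norm_fourierLp (n : ℤ) : ‖(fourierLp (evenExp j) n : LpCirc (evenExp j))‖ = 1 := by
  have h0 : 2 * j ≠ 0 := by have := hj.out; omega
  have h : ‖(fourierLp (evenExp j) n : LpCirc (evenExp j))‖ ^ (2 * j) = 1 := by
    rw [norm_pow_eq_integral]
    have : (fun t => ‖fourierLp (evenExp j) n t‖ ^ (2 * j)) =ᵐ[circMeasure] fun _ => 1 := by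
      filter_upwards [coeFn_fourierLp (evenExp j) n] with t ht
      rw [ht, fourier_apply, Circle.norm_coe, one_pow]
    rw [integral_congr_ae this]
    simp
  exact (pow_eq_one_iff_of_nonneg (norm_nonneg _) h0).1 h

end Norm

/-! ### The functional `Φ_f` on `PD^{2j}` -/

section Functional

lemma PD.coeff_eq {j : ℕ} {G : LpCirc (evenExp j)} (hG : G ∈ PD j) (n : ℤ) :
    fourierCoeff G n = ((fourierCoeff G n).re : ℂ) :=
  Complex.ext rfl (Complex.nonneg_iff.1 (hG n)).2.symm

lemma PD.re_nonneg {j : ℕ} {G : LpCirc (evenExp j)} (hG : G ∈ PD j) (n : ℤ) :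
    0 ≤ (fourierCoeff G n).re := (Complex.nonneg_iff.1 (hG n)).1

lemma phiTerm_nonneg (f : Circ → ℂ) {j : ℕ} {G : LpCirc (evenExp j)} (hG : G ∈ PD j) (n : ℤ) :
    0 ≤ phiTerm f G n := mul_nonneg (norm_nonneg _) (PD.re_nonneg hG n)

variable {j : ℕ} [hj : Fact (1 ≤ j)]

lemma mul_conj_csgn (z : ℂ) : conj (csgn z) * z = ‖z‖ := by
  by_cases h : z = 0
  · simp [h, csgn]
  · have h' : (‖z‖ : ℂ) ≠ 0 := by simpa using h
    rw [csgn, map_div₀, Complex.conj_ofReal, div_mul_eq_mul_div, mul_comm, Complex.mul_conj,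
      Complex.normSq_eq_norm_sq]
    push_cast
    field_simp

lemma norm_csgn_le (z : ℂ) : ‖csgn z‖ ≤ 1 := by
  rw [csgn, norm_div, Complex.norm_real, norm_norm]
  exact div_self_le_one _

/-- The partial sums of `Φ_f(G)` are bounded by `‖f‖ ‖G‖`: multiplying the coefficients of `G` by
unimodular numbers, and cutting them off, does not increase the norm of `G`, by the upper
majorant property. -/
lemma sum_phiTerm_le (f : LpCirc (ENNReal.ofReal (specialExp j))) {G : LpCirc (evenExp j)}
    (hG : G ∈ PD j) (S : Finset ℤ) : ∑ n ∈ S, phiTerm f G n ≤ ‖f‖ * ‖G‖ := by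
  -- The pairing is bilinear, so `T` is built from the conjugate characters; it is majorized by `Ḡ`.
  set d : ℤ → ℂ := fun n => conj (csgn (fourierCoeff f n)) * fourierCoeff G n with hd
  set T : LpCirc (evenExp j) := ∑ n ∈ S, d n • fourierLp (evenExp j) (-n) with hT
  have hpair : pairing _ _ f T = ((∑ n ∈ S, phiTerm f G n : ℝ) : ℂ) := by
    rw [hT, map_sum, Complex.ofReal_sum]
    refine Finset.sum_congr rfl fun n _ => ?_
    rw [map_smul, pairing_fourierLp, smul_eq_mul, hd, phiTerm, Complex.ofReal_mul,
      ← PD.coeff_eq hG n, ← mul_conj_csgn]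
    ring
  have hmaj : Majorizes (fun t => conj (G t)) T := by
    refine majorizes_iff.2 ⟨fun m => (fourierCoeff G (-m)).re, fun m => ?_⟩
    rw [fourierCoeff_conj, PD.coeff_eq hG, Complex.conj_ofReal]
    refine ⟨rfl, ?_⟩
    have hm : fourierCoeff T m = if -m ∈ S then d (-m) else 0 := by
      rw [← coeffCLM_apply, hT, map_sum]
      simp only [map_smul, coeffCLM_fourierLp, smul_eq_mul, mul_ite, mul_one, mul_zero,
        eq_neg_iff_add_eq_zero, ← neg_eq_iff_add_eq_zero]
      rw [Finset.sum_ite_eq]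
    rw [hm]
    split_ifs
    · rw [hd, norm_mul, RCLike.norm_conj]
      refine (mul_le_of_le_one_left (norm_nonneg _) (norm_csgn_le _)).trans ?_
      rw [PD.coeff_eq hG, Complex.norm_real,
        Real.norm_of_nonneg (PD.re_nonneg hG _)]
    · simpa using PD.re_nonneg hG (-m)
  have hnorm : ‖T‖ ≤ ‖G‖ := by
    have h0 : 2 * j ≠ 0 := by have := hj.out; omega
    have := hmaj.integral_norm_pow_le (memLp_conj (Lp.memLp G)) (Lp.memLp T)
    simp only [RCLike.norm_conj] at this
    rw [← norm_pow_eq_integral, ← norm_pow_eq_integral] at this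
    exact (pow_le_pow_iff_left₀ (norm_nonneg _) (norm_nonneg _) h0).1 this
  calc ∑ n ∈ S, phiTerm f G n ≤ ‖pairing _ _ f T‖ := by
        rw [hpair, Complex.norm_real]; exact le_abs_self _
    _ ≤ ‖f‖ * ‖T‖ := norm_pairing_le f T
    _ ≤ ‖f‖ * ‖G‖ := by gcongr

lemma summable_phiTerm (f : LpCirc (ENNReal.ofReal (specialExp j))) {G : LpCirc (evenExp j)}
    (hG : G ∈ PD j) : Summable (phiTerm f G) :=
  summable_of_sum_le (phiTerm_nonneg f hG) (sum_phiTerm_le f hG)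

lemma Phi_le (f : LpCirc (ENNReal.ofReal (specialExp j))) {G : LpCirc (evenExp j)}
    (hG : G ∈ PD j) : Phi f G ≤ ‖f‖ * ‖G‖ :=
  Real.tsum_le_of_sum_le (phiTerm_nonneg f hG) (sum_phiTerm_le f hG)

/-- The tails of `Φ_f(G)` are small uniformly over bounded sets of `G`: approximate `f` by
a trigonometric polynomial. -/
lemma exists_Phi_le_sum_add (f : LpCirc (ENNReal.ofReal (specialExp j))) {ε : ℝ} (hε : 0 < ε) :
    ∃ S : Finset ℤ, ∀ G : LpCirc (evenExp j), G ∈ PD j →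
      Phi f G ≤ ∑ n ∈ S, phiTerm f G n + ε * ‖G‖ := by
  obtain ⟨h, hfh, S, hS⟩ := exists_norm_sub_le_finite_spectrum ENNReal.ofReal_ne_top f hε
  refine ⟨S, fun G hG => Real.tsum_le_of_sum_le (phiTerm_nonneg f hG) fun T => ?_⟩
  have h1 : ∑ n ∈ T \ S, phiTerm f G n = ∑ n ∈ T \ S, phiTerm (f - h : LpCirc _) G n := by
    refine Finset.sum_congr rfl fun n hn => ?_
    rw [phiTerm, phiTerm, ← coeffCLM_apply (f - h), map_sub, coeffCLM_apply, coeffCLM_apply,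
      hS n (Finset.mem_sdiff.1 hn).2, sub_zero]
  calc ∑ n ∈ T, phiTerm f G n
      ≤ ∑ n ∈ S ∪ T, phiTerm f G n :=
        Finset.sum_le_sum_of_subset_of_nonneg Finset.subset_union_right
          fun n _ _ => phiTerm_nonneg f hG n
    _ = ∑ n ∈ S, phiTerm f G n + ∑ n ∈ T \ S, phiTerm f G n := by
        rw [← Finset.union_sdiff_self_eq_union, Finset.sum_union Finset.disjoint_sdiff]
    _ ≤ ∑ n ∈ S, phiTerm f G n + ε * ‖G‖ := by
        rw [h1]
        gcongr
        exact (sum_phiTerm_le (f - h) hG _).trans (by gcongr)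

lemma phiTerm_add (f : Circ → ℂ) (G H : LpCirc (evenExp j)) (n : ℤ) :
    phiTerm f ↑↑(G + H) n = phiTerm f G n + phiTerm f H n := by
  rw [phiTerm, ← coeffCLM_apply (G + H), map_add, Complex.add_re, mul_add]; rfl

lemma phiTerm_smul (f : Circ → ℂ) (c : ℝ) (G : LpCirc (evenExp j)) (n : ℤ) :
    phiTerm f ↑↑((c : ℂ) • G) n = c * phiTerm f G n := by
  rw [phiTerm, ← coeffCLM_apply ((c : ℂ) • G), map_smul, smul_eq_mul, Complex.re_ofReal_mul,
    mul_left_comm]; rfl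

lemma Phi_add (f : LpCirc (ENNReal.ofReal (specialExp j))) {G H : LpCirc (evenExp j)}
    (hG : G ∈ PD j) (hH : H ∈ PD j) : Phi f ↑↑(G + H) = Phi f G + Phi f H := by
  simp only [Phi, phiTerm_add]
  exact (summable_phiTerm f hG).tsum_add (summable_phiTerm f hH)

lemma Phi_smul (f : Circ → ℂ) (c : ℝ) (G : LpCirc (evenExp j)) :
    Phi f ↑↑((c : ℂ) • G) = c * Phi f G := by
  simp only [Phi, phiTerm_smul, tsum_mul_left]

lemma add_mem_PDsupp {f : Circ → ℂ} {G H : LpCirc (evenExp j)} (hG : G ∈ PDsupp j f)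
    (hH : H ∈ PDsupp j f) : G + H ∈ PDsupp j f := by
  constructor
  · intro n
    rw [← coeffCLM_apply, map_add]
    exact add_nonneg (hG.1 n) (hH.1 n)
  · intro n hn
    rw [← coeffCLM_apply, map_add, coeffCLM_apply, coeffCLM_apply, hG.2 n hn, hH.2 n hn, add_zero]

lemma smul_mem_PDsupp {f : Circ → ℂ} {c : ℝ} (hc : 0 ≤ c) {G : LpCirc (evenExp j)}
    (hG : G ∈ PDsupp j f) : (c : ℂ) • G ∈ PDsupp j f := by
  constructor
  · intro n
    rw [← coeffCLM_apply, map_smul]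
    exact mul_nonneg (Complex.zero_le_real.2 hc) (hG.1 n)
  · intro n hn
    rw [← coeffCLM_apply, map_smul, coeffCLM_apply, hG.2 n hn, smul_zero]

lemma fourierLp_mem_PDsupp {f : Circ → ℂ} {k : ℤ} (hk : fourierCoeff f k ≠ 0) :
    fourierLp (evenExp j) k ∈ PDsupp j f := by
  constructor
  · intro n
    rw [← coeffCLM_apply, coeffCLM_fourierLp]
    split_ifs <;> simp
  · intro n hn
    rw [← coeffCLM_apply, coeffCLM_fourierLp, if_neg]
    rintro rfl
    exact hk hn

lemma Phi_fourierLp (f : Circ → ℂ) (k : ℤ) :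
    Phi f ↑↑(fourierLp (evenExp j) k) = ‖fourierCoeff f k‖ := by
  rw [Phi, tsum_eq_single k]
  · rw [phiTerm, ← coeffCLM_apply (fourierLp (evenExp j) k), coeffCLM_fourierLp, if_pos rfl,
      Complex.one_re, mul_one]
  · intro n hn
    rw [phiTerm, ← coeffCLM_apply (fourierLp (evenExp j) k), coeffCLM_fourierLp, if_neg hn,
      Complex.zero_re, mul_zero]

lemma isClosed_PDsupp (f : Circ → ℂ) : IsClosed (PDsupp j f) := by
  have : PDsupp j f = (⋂ n : ℤ, coeffCLM (evenExp j) n ⁻¹' {z | 0 ≤ z}) ∩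
      ⋂ (n : ℤ) (_ : fourierCoeff f n = 0), coeffCLM (evenExp j) n ⁻¹' {0} := by
    ext G
    simp [PDsupp, PD]
  rw [this]
  exact (isClosed_iInter fun n => isClosed_Ici.preimage (coeffCLM _ n).continuous).inter
    (isClosed_iInter fun n => isClosed_iInter fun _ =>
      isClosed_singleton.preimage (coeffCLM _ n).continuous)

lemma tendsto_phiTerm (f : Circ → ℂ) {u : ℕ → LpCirc (evenExp j)} {G : LpCirc (evenExp j)}
    (h : Tendsto u atTop (𝓝 G)) (n : ℤ) :
    Tendsto (fun i => phiTerm f (u i) n) atTop (𝓝 (phiTerm f G n)) :=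
  ((Complex.continuous_re.comp (coeffCLM (evenExp j) n).continuous).tendsto G |>.comp h).const_mul _

end Functional

/-! ### Existence and uniqueness of the maximizer -/

section Maximizer

variable {j : ℕ} [hj : Fact (1 ≤ j)]

/-- A bound for `Φ_f` on a sphere extends to the whole cone by homogeneity. -/
lemma mul_Phi_le (f : LpCirc (ENNReal.ofReal (specialExp j))) {c M : ℝ} (hc : 0 < c)
    (hM : ∀ H ∈ PDsupp j f, ‖H‖ = c → Phi f H ≤ M) {H : LpCirc (evenExp j)}
    (hH : H ∈ PDsupp j f) : c * Phi f H ≤ M * ‖H‖ := by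
  rcases eq_or_lt_of_le (norm_nonneg H) with h0 | h0
  · have := Phi_le f hH.1
    rw [← h0, mul_zero] at this ⊢
    exact mul_nonpos_of_nonneg_of_nonpos hc.le this
  · have h := hM _ (smul_mem_PDsupp (c := c / ‖H‖) (by positivity) hH) (by
      rw [norm_smul, Complex.norm_real, Real.norm_of_nonneg (by positivity)]
      field_simp)
    rw [Phi_smul, div_mul_eq_mul_div, div_le_iff₀ h0] at h
    exact h

/-- Two near-maximizers are close together, by Clarkson's inequality: `Φ_f` is nearly maximal at
their midpoint, which therefore cannot have a much smaller norm. -/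
lemma norm_sub_pow_le (f : LpCirc (ENNReal.ofReal (specialExp j))) {c M δ : ℝ} (hc : 0 < c)
    (hM0 : 0 < M) (hM : ∀ H ∈ PDsupp j f, ‖H‖ = c → Phi f H ≤ M) (hδ : δ ≤ 1)
    {G H : LpCirc (evenExp j)} (hG : G ∈ PDsupp j f) (hH : H ∈ PDsupp j f) (hGc : ‖G‖ = c)
    (hHc : ‖H‖ = c) (hG1 : M * (1 - δ) ≤ Phi f G) (hH1 : M * (1 - δ) ≤ Phi f H) :
    ‖G - H‖ ^ (2 * j) ≤ (2 * c) ^ (2 * j) * (2 * j * δ) := by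
  have h1 : 2 * c * (1 - δ) ≤ ‖G + H‖ := by
    have := mul_Phi_le f hc hM (add_mem_PDsupp hG hH)
    rw [Phi_add f hG.1 hH.1] at this
    refine le_of_mul_le_mul_left ?_ hM0
    calc M * (2 * c * (1 - δ)) = c * (M * (1 - δ) + M * (1 - δ)) := by ring
      _ ≤ c * (Phi f G + Phi f H) := by gcongr
      _ ≤ M * ‖G + H‖ := this
  have h2 : (2 * c) ^ (2 * j) * (1 - 2 * j * δ) ≤ ‖G + H‖ ^ (2 * j) := by
    have hb := one_add_mul_le_pow (a := -δ) (by linarith) (2 * j)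
    push_cast at hb
    calc (2 * c) ^ (2 * j) * (1 - 2 * j * δ) ≤ (2 * c) ^ (2 * j) * (1 + -δ) ^ (2 * j) := by
          gcongr; linarith
      _ = (2 * c * (1 - δ)) ^ (2 * j) := by rw [← mul_pow, sub_eq_add_neg]
      _ ≤ ‖G + H‖ ^ (2 * j) :=
          pow_le_pow_left₀ (mul_nonneg (by positivity) (by linarith)) h1 _
  have h3 := clarkson G H
  rw [hGc, hHc, ← two_mul, mul_left_comm, ← mul_pow] at h3
  linarith

lemma exists_maximizer (f : LpCirc (ENNReal.ofReal (specialExp j))) {c : ℝ} (hc : 0 < c) {k : ℤ}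
    (hk : fourierCoeff f k ≠ 0) :
    ∃ G : LpCirc (evenExp j), (G ∈ PDsupp j f ∧ ‖G‖ = c) ∧ 0 < Phi f G ∧
      ∀ H ∈ PDsupp j f, ‖H‖ = c → Phi f H ≤ Phi f G := by
  set A : Set ℝ := {x | ∃ G : LpCirc (evenExp j), (G ∈ PDsupp j f ∧ ‖G‖ = c) ∧ Phi f G = x}
    with hA
  -- Hölder bounds `Φ_f` above on the sphere; a multiple of a character makes it positive.
  have hbdd : BddAbove A := by
    refine ⟨‖f‖ * c, ?_⟩
    rintro x ⟨G, ⟨hG, rfl⟩, rfl⟩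
    exact Phi_le f hG.1
  have hmem : c * ‖fourierCoeff f k‖ ∈ A := by
    refine ⟨(c : ℂ) • fourierLp (evenExp j) k,
      ⟨smul_mem_PDsupp hc.le (fourierLp_mem_PDsupp hk), ?_⟩, ?_⟩
    · rw [norm_smul, norm_fourierLp, Complex.norm_real, Real.norm_of_nonneg hc.le, mul_one]
    · rw [Phi_smul, Phi_fourierLp]
  set M := sSup A with hMdef
  have hM : ∀ H ∈ PDsupp j f, ‖H‖ = c → Phi f H ≤ M := fun H hH hHc =>
    le_csSup hbdd ⟨H, ⟨hH, hHc⟩, rfl⟩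
  have hM0 : 0 < M :=
    (mul_pos hc (norm_pos_iff.2 hk)).trans_le (le_csSup hbdd hmem)
  have hseq : ∀ n : ℕ, ∃ G : LpCirc (evenExp j), (G ∈ PDsupp j f ∧ ‖G‖ = c) ∧
      M * (1 - 1 / ((n : ℝ) + 1)) < Phi f G := by
    intro n
    have : M * (1 - 1 / ((n : ℝ) + 1)) < M :=
      mul_lt_of_lt_one_right hM0 (sub_lt_self _ Nat.one_div_pos_of_nat)
    obtain ⟨_, ⟨G, hG, rfl⟩, hlt⟩ := exists_lt_of_lt_csSup ⟨_, hmem⟩ this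
    exact ⟨G, hG, hlt⟩
  choose u hu hu1 using hseq
  have hcauchy : CauchySeq u := by
    have hlim : Tendsto (fun n : ℕ => (2 * c) ^ (2 * j) * (2 * j * (1 / ((n : ℝ) + 1)))) atTop
        (𝓝 0) := by
      simpa using (tendsto_one_div_add_atTop_nhds_zero_nat (𝕜 := ℝ)).const_mul (2 * (j : ℝ))
        |>.const_mul ((2 * c) ^ (2 * j))
    refine Metric.cauchySeq_iff'.2 fun ε hε => ?_
    obtain ⟨N, hN⟩ := (hlim.eventually (gt_mem_nhds (pow_pos hε (2 * j)))).exists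
    refine ⟨N, fun n hn => ?_⟩
    have hmono : M * (1 - 1 / ((N : ℝ) + 1)) ≤ M * (1 - 1 / ((n : ℝ) + 1)) := by gcongr
    have := norm_sub_pow_le f hc hM0 hM
      ((div_le_one (by positivity)).2 (by linarith [(Nat.cast_nonneg N : (0 : ℝ) ≤ N)]))
      (hu n).1 (hu N).1 (hu n).2 (hu N).2 (hmono.trans (hu1 n).le) (hu1 N).le
    rw [dist_eq_norm]
    exact lt_of_pow_lt_pow_left₀ _ hε.le (this.trans_lt hN)
  obtain ⟨G, hG⟩ := cauchySeq_tendsto_of_complete hcauchy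
  have hGs : G ∈ PDsupp j f :=
    (isClosed_PDsupp (f : Circ → ℂ)).mem_of_tendsto hG (Eventually.of_forall fun n => (hu n).1)
  have hGc : ‖G‖ = c := by
    refine tendsto_nhds_unique hG.norm ?_
    simp only [(hu _).2, tendsto_const_nhds]
  -- `Φ_f` is upper semicontinuous along the sequence, since its tails are uniformly small.
  have hGM : M ≤ Phi f G := by
    refine le_of_forall_pos_le_add fun ε hε => ?_
    obtain ⟨S, hS⟩ := exists_Phi_le_sum_add f (div_pos hε hc)
    have hlim1 : Tendsto (fun n : ℕ => M * (1 - 1 / ((n : ℝ) + 1))) atTop (𝓝 M) := by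
      simpa using ((tendsto_one_div_add_atTop_nhds_zero_nat (𝕜 := ℝ)).const_sub 1).const_mul M
    have hlim2 : Tendsto (fun n => ∑ m ∈ S, phiTerm f (u n) m + ε) atTop
        (𝓝 (∑ m ∈ S, phiTerm f G m + ε)) :=
      (tendsto_finsetSum S fun m _ => tendsto_phiTerm f hG m).add_const ε
    refine (le_of_tendsto_of_tendsto' hlim1 hlim2 fun n => ?_).trans ?_
    · refine (hu1 n).le.trans ((hS _ (hu n).1.1).trans_eq ?_)
      rw [(hu n).2, div_mul_cancel₀ _ hc.ne']
    · gcongr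
      exact (summable_phiTerm f hGs.1).sum_le_tsum S fun m _ => phiTerm_nonneg f hGs.1 m
  exact ⟨G, ⟨hGs, hGc⟩, hM0.trans_le hGM, fun H hH hHc => (hM H hH hHc).trans hGM⟩

end Maximizer

/-! ### The product `(G Ḡ)^{j-1} G` and the first variation of the norm -/

section PowProd

lemma norm_powProd {j : ℕ} (hj : 1 ≤ j) (u : Circ → ℂ) (t : Circ) :
    ‖powProd j u t‖ = ‖u t‖ ^ (2 * j - 1) := by
  rw [powProd, norm_mul, norm_pow, norm_mul, RCLike.norm_conj, ← sq, ← pow_mul, ← pow_succ]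
  congr 1
  omega

lemma aestronglyMeasurable_powProd (j : ℕ) {u : Circ → ℂ}
    (hu : AEStronglyMeasurable u circMeasure) :
    AEStronglyMeasurable (powProd j u) circMeasure :=
  ((hu.mul (Complex.continuous_conj.comp_aestronglyMeasurable hu)).pow _).mul hu

lemma integrable_powProd {j : ℕ} (hj : 1 ≤ j) {u : Circ → ℂ}
    (hu : MemLp u (evenExp j) circMeasure) : Integrable (powProd j u) circMeasure := by
  refine (integrable_norm_iff (aestronglyMeasurable_powProd j hu.1)).1 ?_
  simp only [norm_powProd hj]
  exact integrable_norm_pow (by omega) hu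

/-- The coefficients of `(G Ḡ)^{j-1} G` are nonnegative if those of `G` are, as it is the product
of `G ^ j` and `Ḡ ^ (j - 1)`. -/
lemma fourierCoeff_powProd_nonneg {j : ℕ} (hj : 1 ≤ j) {G : LpCirc (evenExp j)} (hG : G ∈ PD j)
    (n : ℤ) : 0 ≤ fourierCoeff (powProd j G) n := by
  have h : Majorizes G G := majorizes_self_iff.2 hG
  have hm := Lp.memLp G
  have h1 := (h.pow le_rfl hm hm).mul (memLp_pow le_rfl hm)
    (memLp_pow (Nat.sub_le j 1) (memLp_conj hm)) (memLp_pow le_rfl hm)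
    (memLp_pow (Nat.sub_le j 1) (memLp_conj hm))
    (h.conj.pow (Nat.sub_le j 1) (memLp_conj hm) (memLp_conj hm))
  have h2 : powProd j G = fun t => G t ^ j * conj (G t) ^ (j - 1) := by
    ext t
    obtain ⟨k, rfl⟩ := Nat.exists_eq_add_of_le' hj
    rw [powProd, Nat.add_sub_cancel]
    ring
  rw [h2]
  exact majorizes_self_iff.1 h1 n

/-- The tangent-line inequality for the convex function `x ^ j`. -/
lemma pow_sub_pow_le_mul {x y : ℝ} (hx : 0 ≤ x) (hy : 0 ≤ y) (k : ℕ) :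
    x ^ (k + 1) - y ^ (k + 1) ≤ (k + 1) * x ^ k * (x - y) := by
  induction k with
  | zero => simp
  | succ k ih =>
    have h1 := mul_le_mul_of_nonneg_left ih hy
    have h2 : 0 ≤ (k + 1) * x ^ k * (x - y) ^ 2 := by positivity
    have h3 : ((k + 1 : ℕ) : ℝ) + 1 = k + 2 := by push_cast; ring
    rw [h3]
    have h4 : x ^ (k + 1 + 1) - y ^ (k + 1 + 1) = y * (x ^ (k + 1) - y ^ (k + 1))
        + x ^ (k + 1) * (x - y) := by ring
    have h5 : (k + 2) * x ^ (k + 1) * (x - y) = y * ((k + 1) * x ^ k * (x - y))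
        + x ^ (k + 1) * (x - y) + (k + 1) * x ^ k * (x - y) ^ 2 := by ring
    linarith

lemma norm_add_pow_sub_le {j : ℕ} (hj : 1 ≤ j) (u : Circ → ℂ) (n : ℤ) {s : ℝ} (t : Circ) :
    ‖u t + s * fourier n t‖ ^ (2 * j) - ‖u t‖ ^ (2 * j) ≤
      2 * j * s * (fourier (-n) t • powProd j (fun x => u x + s * fourier n x) t).re := by
  obtain ⟨k, rfl⟩ := Nat.exists_eq_add_of_le' hj
  set e : ℂ := fourier n t with he
  have hen : ‖e‖ = 1 := by rw [he, fourier_apply, Circle.norm_coe]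
  set w : ℂ := u t + s * e with hw
  have hu : u t = w - s * e := by rw [hw]; ring
  have hre : (fourier (-n) t • powProd (k + 1) (fun x => u x + s * fourier n x) t).re
      = (‖w‖ ^ 2) ^ k * (conj e * w).re := by
    rw [fourier_neg, ← he, powProd, ← he, ← hw, Nat.add_sub_cancel, smul_eq_mul, Complex.mul_conj,
      Complex.normSq_eq_norm_sq, ← Complex.ofReal_pow, mul_left_comm, Complex.re_ofReal_mul]
  have hsq : ‖w‖ ^ 2 - ‖u t‖ ^ 2 ≤ 2 * s * (conj e * w).re := by
    have h1 : ‖e‖ ^ 2 = 1 := by rw [hen, one_pow]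
    rw [hu]
    rw [← Complex.normSq_eq_norm_sq, Complex.normSq_apply] at h1 ⊢
    rw [← Complex.normSq_eq_norm_sq, Complex.normSq_apply]
    rw [Complex.sub_re, Complex.sub_im, Complex.re_ofReal_mul, Complex.im_ofReal_mul,
      Complex.mul_re, Complex.conj_re, Complex.conj_im]
    have h2 : s ^ 2 * (e.re * e.re + e.im * e.im) = s ^ 2 := by rw [h1, mul_one]
    nlinarith [sq_nonneg s]
  rw [hre, pow_mul, pow_mul]
  calc (‖w‖ ^ 2) ^ (k + 1) - (‖u t‖ ^ 2) ^ (k + 1)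
      ≤ (k + 1) * (‖w‖ ^ 2) ^ k * (‖w‖ ^ 2 - ‖u t‖ ^ 2) :=
        pow_sub_pow_le_mul (sq_nonneg _) (sq_nonneg _) k
    _ ≤ (k + 1) * (‖w‖ ^ 2) ^ k * (2 * s * (conj e * w).re) := by gcongr
    _ = _ := by push_cast; ring

lemma memLp_add_fourier {q : ℝ≥0∞} {u : Circ → ℂ} (hu : MemLp u q circMeasure) (s : ℝ) (n : ℤ) :
    MemLp (fun t => u t + s * fourier n t) q circMeasure := by
  have : MemLp (fun t : Circ => (s : ℂ) * fourier n t) q circMeasure := by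
    simpa only [mul_comm] using memLp_fourier_mul (memLp_const (s : ℂ)) n
  exact hu.add this

/-- An upper bound for the increment of `‖u‖_{2j}^{2j}` when the coefficient of `u` at `n` is
increased by `s`. -/
lemma integral_norm_add_pow_sub_le {j : ℕ} (hj : 1 ≤ j) {u : Circ → ℂ}
    (hu : MemLp u (evenExp j) circMeasure) (n : ℤ) (s : ℝ) :
    ∫ t, ‖u t + s * fourier n t‖ ^ (2 * j) ∂circMeasure - ∫ t, ‖u t‖ ^ (2 * j) ∂circMeasure ≤
      2 * j * s * (fourierCoeff (powProd j (fun t => u t + s * fourier n t)) n).re := by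
  have hw := memLp_add_fourier hu s n
  have h1 := integrable_norm_pow le_rfl hw
  have h2 := integrable_norm_pow le_rfl hu
  have h3 := (integrable_powProd hj hw).fourier_smul (-n)
  have h4 : (fourierCoeff (powProd j (fun t => u t + s * fourier n t)) n).re =
      ∫ t, (fourier (-n) t • powProd j (fun x => u x + s * fourier n x) t).re ∂circMeasure :=
    (integral_re h3).symm
  rw [h4, ← integral_sub h1 h2, ← integral_const_mul]
  exact integral_mono (h1.sub h2) (h3.re.const_mul _) fun t => norm_add_pow_sub_le hj u n t

/-- The coefficients of the product depend continuously on the perturbation, by dominated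
convergence with the majorant `(‖u‖ + 1) ^ (2j - 1)`. -/
lemma tendsto_fourierCoeff_powProd {j : ℕ} (hj : 1 ≤ j) {u : Circ → ℂ}
    (hu : MemLp u (evenExp j) circMeasure) (n : ℤ) :
    Tendsto (fun s : ℝ => fourierCoeff (powProd j (fun t => u t + s * fourier n t)) n) (𝓝[>] 0)
      (𝓝 (fourierCoeff (powProd j u) n)) := by
  refine tendsto_integral_filter_of_dominated_convergence
    (fun t => 2 ^ (2 * j - 1 - 1) * (‖u t‖ ^ (2 * j - 1) + 1 ^ (2 * j - 1))) ?_ ?_ ?_ ?_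
  · refine Eventually.of_forall fun s => ?_
    exact ((integrable_powProd hj (memLp_add_fourier hu s n)).fourier_smul (-n)).1
  · filter_upwards [Ioc_mem_nhdsGT zero_lt_one] with s hs
    refine ae_of_all _ fun t => ?_
    rw [norm_smul, norm_powProd hj, fourier_apply, Circle.norm_coe, one_mul]
    refine (pow_le_pow_left₀ (norm_nonneg _) ?_ _).trans
      (add_pow_le (norm_nonneg _) zero_le_one _)
    refine (norm_add_le _ _).trans ?_
    gcongr
    rw [norm_mul, fourier_apply, Circle.norm_coe, mul_one, Complex.norm_real,
      Real.norm_of_nonneg hs.1.le]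
    exact hs.2
  · exact ((integrable_norm_pow (by omega) hu).add (integrable_const _)).const_mul _
  · refine ae_of_all _ fun t => ?_
    have hc : Continuous fun s : ℝ =>
        fourier (-n) t • powProd j (fun t => u t + s * fourier n t) t := by
      unfold powProd
      fun_prop
    have := hc.tendsto 0
    simp only [Complex.ofReal_zero, zero_mul, powProd, add_zero] at this
    exact tendsto_nhdsWithin_of_tendsto_nhds this

end PowProd

/-! ### Majorization by the extremal product -/

section Extremal

lemma specialExp_sub_one_mul {j : ℕ} (hj : 1 ≤ j) : (2 * (j : ℝ) - 1) * (specialExp j - 1) = 1 := by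
  have : (1 : ℝ) ≤ j := by exact_mod_cast hj
  have h : 2 * (j : ℝ) - 1 ≠ 0 := by linarith
  rw [specialExp]
  field_simp
  ring

lemma norm_dualFun {p : ℝ} (hp : 1 < p) (f : Circ → ℂ) (t : Circ) :
    ‖dualFun p f t‖ = ‖‖f t‖ ^ (p - 1)‖ := by
  rw [dualFun, norm_mul, Complex.norm_real]
  by_cases h : f t = 0
  · simp [h, Real.zero_rpow (sub_pos.2 hp).ne', csgn]
  · rw [csgn, norm_div, Complex.norm_real, norm_norm, div_self (norm_ne_zero_iff.2 h), mul_one]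

lemma aestronglyMeasurable_dualFun (p : ℝ) {f : Circ → ℂ}
    (hf : AEStronglyMeasurable f circMeasure) :
    AEStronglyMeasurable (dualFun p f) circMeasure := by
  have h := hf.aemeasurable
  refine AEMeasurable.aestronglyMeasurable ?_
  unfold dualFun csgn
  fun_prop

lemma mem_PDnorm_iff {j : ℕ} {g f : Circ → ℂ} (hg : MemLp g (evenExp j) circMeasure)
    {G : LpCirc (evenExp j)} :
    G ∈ PDnorm j g f ↔ G ∈ PDsupp j f ∧ ‖G‖ = (eLpNorm g (evenExp j) circMeasure).toReal := by
  rw [Lp.norm_def, ENNReal.toReal_eq_toReal_iff' (Lp.eLpNorm_ne_top G) hg.2.ne]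
  rfl

lemma isMaximizer_iff {j : ℕ} {g f : Circ → ℂ} (hg : MemLp g (evenExp j) circMeasure)
    {G : LpCirc (evenExp j)} :
    IsMaximizer j g f G ↔
      (G ∈ PDsupp j f ∧ ‖G‖ = (eLpNorm g (evenExp j) circMeasure).toReal) ∧
      ∀ H ∈ PDsupp j f, ‖H‖ = (eLpNorm g (evenExp j) circMeasure).toReal →
        Phi f H ≤ Phi f G := by
  simp only [IsMaximizer, mem_PDnorm_iff hg, and_imp]

variable {j : ℕ} [hj : Fact (1 ≤ j)]

/-- The Euler–Lagrange inequality at a maximizer `G`: since adding a multiple of a character to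
`G` cannot increase the ratio `Φ_f(G) / ‖G‖`, the coefficients of `(G Ḡ)^{j-1} G` are bounded
below by multiples of those of `f`. -/
lemma norm_fourierCoeff_mul_le (f : LpCirc (ENNReal.ofReal (specialExp j))) {c : ℝ} (hc : 0 < c)
    {G : LpCirc (evenExp j)} (hG : G ∈ PDsupp j f) (hGc : ‖G‖ = c) (hG0 : 0 < Phi f G)
    (hM : ∀ H ∈ PDsupp j f, ‖H‖ = c → Phi f H ≤ Phi f G) {n : ℤ} (hn : fourierCoeff f n ≠ 0) :
    c ^ (2 * j) * ‖fourierCoeff f n‖ ≤ Phi f G * (fourierCoeff (powProd j G) n).re := by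
  have hj0 : (0 : ℝ) < j := by exact_mod_cast hj.out
  set a := ‖fourierCoeff f n‖ with ha
  have hlim := ((Complex.continuous_re.tendsto _).comp
    (tendsto_fourierCoeff_powProd hj.out (Lp.memLp G) n)).const_mul (Phi f G)
  refine ge_of_tendsto hlim ?_
  filter_upwards [self_mem_nhdsWithin] with s (hs : 0 < s)
  set H : LpCirc (evenExp j) := G + (s : ℂ) • fourierLp (evenExp j) n with hH
  have hHs := smul_mem_PDsupp hs.le (fourierLp_mem_PDsupp (j := j) hn)
  have h1 := mul_Phi_le f hc hM (add_mem_PDsupp hG hHs)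
  rw [Phi_add f hG.1 hHs.1, Phi_smul, Phi_fourierLp, ← ha, ← hH] at h1
  -- Maximality bounds the norm of `G + s e_n` below to first order in `s`; the tangent-line
  -- inequality bounds it above, and the factor `2 j s` cancels.
  have h2 : c * (1 + s * a / Phi f G) ≤ ‖H‖ := by
    refine le_of_mul_le_mul_left ?_ hG0
    calc Phi f G * (c * (1 + s * a / Phi f G)) = c * (Phi f G + s * a) := by field_simp
      _ ≤ Phi f G * ‖H‖ := h1
  have hq : 0 ≤ s * a / Phi f G := by positivity
  have h3 : c ^ (2 * j) * (1 + 2 * j * (s * a / Phi f G)) ≤ ‖H‖ ^ (2 * j) := by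
    have hb := one_add_mul_le_pow (a := s * a / Phi f G) (by linarith) (2 * j)
    push_cast at hb
    calc c ^ (2 * j) * (1 + 2 * j * (s * a / Phi f G))
        ≤ c ^ (2 * j) * (1 + s * a / Phi f G) ^ (2 * j) := by gcongr
      _ = (c * (1 + s * a / Phi f G)) ^ (2 * j) := by rw [mul_pow]
      _ ≤ ‖H‖ ^ (2 * j) := pow_le_pow_left₀ (by positivity) h2 _
  have h4 := integral_norm_add_pow_sub_le hj.out (Lp.memLp G) n s
  have h5 : ‖H‖ ^ (2 * j) = ∫ t, ‖G t + s * fourier n t‖ ^ (2 * j) ∂circMeasure := by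
    rw [norm_pow_eq_integral]
    refine integral_congr_ae ?_
    filter_upwards [Lp.coeFn_add G ((s : ℂ) • fourierLp (evenExp j) n),
      Lp.coeFn_smul (s : ℂ) (fourierLp (evenExp j) n),
      coeFn_fourierLp (evenExp j) n] with t e1 e2 e3
    rw [hH, e1, Pi.add_apply, e2, Pi.smul_apply, e3, smul_eq_mul]
  rw [← h5, ← norm_pow_eq_integral, hGc] at h4
  set r := (fourierCoeff (powProd j fun t => G t + s * fourier n t) n).re with hr
  have h6 : c ^ (2 * j) * (2 * j * (s * a / Phi f G)) ≤ 2 * j * s * r := by linarith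
  have h7 : 2 * j * s * (c ^ (2 * j) * a / Phi f G) ≤ 2 * j * s * r := by
    refine le_of_eq_of_le ?_ h6
    ring
  have h8 := le_of_mul_le_mul_left h7 (by positivity)
  rw [div_le_iff₀ hG0] at h8
  simp only [Function.comp_apply]
  linarith

lemma eLpNorm_dualFun (f : Circ → ℂ) :
    eLpNorm (dualFun (specialExp j) f) (evenExp j) circMeasure =
      eLpNorm f (ENNReal.ofReal (specialExp j)) circMeasure ^ (specialExp j - 1) := by
  have hp := (holderConjugate_specialExp hj.out).lt
  rw [eLpNorm_congr_norm_ae (ae_of_all _ (norm_dualFun hp f)),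
    eLpNorm_norm_rpow f (sub_pos.2 hp), evenExp_eq_ofReal, ← ENNReal.ofReal_mul (by positivity)]
  congr 3
  linarith [specialExp_sub_one_mul hj.out]

lemma memLp_dualFun (f : LpCirc (ENNReal.ofReal (specialExp j))) :
    MemLp (dualFun (specialExp j) f) (evenExp j) circMeasure := by
  refine ⟨aestronglyMeasurable_dualFun _ (Lp.aestronglyMeasurable f), ?_⟩
  rw [eLpNorm_dualFun]
  exact ENNReal.rpow_lt_top_of_nonneg
    (sub_pos.2 (holderConjugate_specialExp hj.out).lt).le (Lp.eLpNorm_ne_top f)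

lemma eLpNorm_powProd (u : Circ → ℂ) :
    eLpNorm (powProd j u) (ENNReal.ofReal (specialExp j)) circMeasure =
      eLpNorm u (evenExp j) circMeasure ^ (2 * (j : ℝ) - 1) := by
  have h1 : (1 : ℝ) ≤ j := by exact_mod_cast hj.out
  have h2 : ∀ t, ‖powProd j u t‖ = ‖‖u t‖ ^ (2 * (j : ℝ) - 1)‖ := by
    intro t
    rw [Real.norm_of_nonneg (by positivity), norm_powProd hj.out, ← Real.rpow_natCast]
    congr 1
    rw [Nat.cast_sub (by have := hj.out; omega)]
    push_cast
    ring
  rw [eLpNorm_congr_norm_ae (ae_of_all _ h2), eLpNorm_norm_rpow u (by linarith),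
    evenExp_eq_ofReal, ← ENNReal.ofReal_mul (holderConjugate_specialExp hj.out).nonneg]
  congr 3
  linarith [specialExp_sub_one_mul hj.out]

/-- A function in `L^p` all of whose Fourier coefficients vanish is zero: test it against
`|f|^{p-1} sgn f`. -/
lemma eq_zero_of_fourierCoeff_eq_zero {f : LpCirc (ENNReal.ofReal (specialExp j))}
    (hf : ∀ n, fourierCoeff f n = 0) : f = 0 := by
  have hg := memLp_conj (memLp_dualFun f)
  have h0 := pairing_eq_zero (evenExp_ne_top j) hf (hg.toLp _)
  have hpt : ∀ t, f t * conj (dualFun (specialExp j) f t) =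
      ((‖f t‖ ^ (specialExp j - 1) * ‖f t‖ : ℝ) : ℂ) := by
    intro t
    rw [dualFun, map_mul, Complex.conj_ofReal, Complex.ofReal_mul, ← mul_conj_csgn (f t)]
    ring
  have hint : Integrable (fun t => ‖f t‖ ^ (specialExp j - 1) * ‖f t‖) circMeasure := by
    have := (MemLp.integrable_mul (Lp.memLp f) hg).re
    refine this.congr (ae_of_all _ fun t => ?_)
    simp only [Pi.mul_apply, hpt]
    exact Complex.ofReal_re _
  rw [pairing_eq_integral] at h0
  have h1 : ∫ t, ‖f t‖ ^ (specialExp j - 1) * ‖f t‖ ∂circMeasure = 0 := by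
    rw [← Complex.ofReal_eq_zero, ← integral_complex_ofReal, ← h0]
    refine integral_congr_ae ?_
    filter_upwards [hg.coeFn_toLp] with t ht
    rw [ht, hpt]
  rw [integral_eq_zero_iff_of_nonneg (fun t => by positivity) hint] at h1
  refine Lp.eq_zero_iff_ae_eq_zero.2 ?_
  filter_upwards [h1] with t ht
  by_contra h
  have : 0 < ‖f t‖ := norm_pos_iff.2 h
  exact (by positivity : 0 < ‖f t‖ ^ (specialExp j - 1) * ‖f t‖).ne' ht

/-- `‖f‖_p = ‖g‖_{2j}^{2j-1}` for `g = |f|^{p-1} sgn f`. -/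
lemma eLpNorm_dualFun_rpow (f : Circ → ℂ) :
    eLpNorm (dualFun (specialExp j) f) (evenExp j) circMeasure ^ (2 * (j : ℝ) - 1) =
      eLpNorm f (ENNReal.ofReal (specialExp j)) circMeasure := by
  rw [eLpNorm_dualFun, ← ENNReal.rpow_mul, mul_comm (specialExp j - 1),
    specialExp_sub_one_mul hj.out, ENNReal.rpow_one]

lemma toReal_eLpNorm_dualFun_pow (f : LpCirc (ENNReal.ofReal (specialExp j))) :
    (eLpNorm (dualFun (specialExp j) f) (evenExp j) circMeasure).toReal ^ (2 * j - 1) = ‖f‖ := by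
  rw [Lp.norm_def, ← eLpNorm_dualFun_rpow, ← ENNReal.toReal_rpow, ← Real.rpow_natCast,
    Nat.cast_sub (by have := hj.out; omega)]
  push_cast
  rfl

lemma existsUnique_isMaximizer (f : LpCirc (ENNReal.ofReal (specialExp j))) :
    ∃! G : LpCirc (evenExp j), IsMaximizer j (dualFun (specialExp j) f) f G := by
  simp only [isMaximizer_iff (memLp_dualFun f)]
  have hcf := toReal_eLpNorm_dualFun_pow f
  have hc0 : 0 ≤ (eLpNorm (dualFun (specialExp j) f) (evenExp j) circMeasure).toReal :=
    ENNReal.toReal_nonneg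
  set c := (eLpNorm (dualFun (specialExp j) f) (evenExp j) circMeasure).toReal
  have h2j : 2 * j - 1 ≠ 0 := by have := hj.out; omega
  by_cases hf : ∀ n, fourierCoeff f n = 0
  · -- For `f = 0` the only competitor is `0`.
    have hc : c = 0 := by
      rw [eq_zero_of_fourierCoeff_eq_zero hf, norm_zero] at hcf
      exact eq_zero_of_pow_eq_zero hcf
    have hmem : (0 : LpCirc (evenExp j)) ∈ PDsupp j f := by
      constructor
      · intro n
        rw [← coeffCLM_apply, map_zero]
      · intro n _
        rw [← coeffCLM_apply, map_zero]
    refine ⟨0, ⟨⟨hmem, by rw [hc, norm_zero]⟩, fun H _ hH => ?_⟩, fun G hG => ?_⟩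
    · rw [hc, norm_eq_zero] at hH
      rw [hH]
    · rw [← norm_eq_zero, hG.1.2, hc]
  · push Not at hf
    obtain ⟨k, hk⟩ := hf
    have hc : 0 < c := by
      refine hc0.lt_of_ne fun h => hk ?_
      rw [← h, zero_pow h2j, eq_comm, norm_eq_zero] at hcf
      rw [hcf, ← coeffCLM_apply, map_zero]
    obtain ⟨G, hG, hG0, hM⟩ := exists_maximizer f hc hk
    refine ⟨G, ⟨hG, hM⟩, fun H hH => ?_⟩
    have hHG : Phi f G ≤ Phi f H := hH.2 G hG.1 hG.2
    have := norm_sub_pow_le f hc hG0 hM zero_le_one hH.1.1 hG.1 hH.1.2 hG.2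
      (by simpa using hHG) (by simp)
    rw [mul_zero, mul_zero] at this
    have h0 := eq_zero_of_pow_eq_zero (this.antisymm (by positivity))
    exact sub_eq_zero.1 (norm_eq_zero.1 h0)

lemma IsMaximizer.majorizes {f : LpCirc (ENNReal.ofReal (specialExp j))} {G : LpCirc (evenExp j)}
    (h : IsMaximizer j (dualFun (specialExp j) f) f G) : Majorizes (powProd j G) f := by
  obtain ⟨⟨hG, hGc⟩, hM⟩ := (isMaximizer_iff (memLp_dualFun f)).1 h
  have hcf := toReal_eLpNorm_dualFun_pow f
  have hc0 : 0 ≤ (eLpNorm (dualFun (specialExp j) f) (evenExp j) circMeasure).toReal :=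
    ENNReal.toReal_nonneg
  set c := (eLpNorm (dualFun (specialExp j) f) (evenExp j) circMeasure).toReal
  have h2j : 2 * j - 1 ≠ 0 := by have := hj.out; omega
  intro n
  have hF := fourierCoeff_powProd_nonneg hj.out hG.1 n
  by_cases hn : fourierCoeff f n = 0
  · simpa [hn] using hF
  have hc : 0 < c := by
    refine hc0.lt_of_ne fun h => hn ?_
    rw [← h, zero_pow h2j, eq_comm, norm_eq_zero] at hcf
    rw [hcf, ← coeffCLM_apply, map_zero]
  obtain ⟨G', hG', hG'0, -⟩ := exists_maximizer f hc hn
  have hG0 : 0 < Phi f G := hG'0.trans_le (hM G' hG'.1 hG'.2)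
  have hle := norm_fourierCoeff_mul_le f hc hG hGc hG0 hM hn
  have hF' := Complex.nonneg_iff.1 hF
  -- Hölder's inequality, with `‖f‖ = c ^ (2j - 1)`
  have hPhi : Phi f G ≤ c ^ (2 * j) := by
    refine (Phi_le f hG.1).trans_eq ?_
    rw [hGc, ← hcf, ← pow_succ]
    congr 1
    have := hj.out
    omega
  refine Complex.le_def.2 ⟨?_, by rw [Complex.ofReal_im]; exact hF'.2⟩
  rw [Complex.ofReal_re]
  refine le_of_mul_le_mul_left (hle.trans ?_) (pow_pos hc (2 * j))
  exact mul_le_mul_of_nonneg_right hPhi hF'.1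

lemma IsMaximizer.eLpNorm_powProd_eq {f : LpCirc (ENNReal.ofReal (specialExp j))}
    {G : LpCirc (evenExp j)} (h : IsMaximizer j (dualFun (specialExp j) f) f G) :
    eLpNorm (powProd j G) (ENNReal.ofReal (specialExp j)) circMeasure =
      eLpNorm f (ENNReal.ofReal (specialExp j)) circMeasure := by
  rw [eLpNorm_powProd, h.1.2, eLpNorm_dualFun_rpow]

end Extremal

end LowerMajorant

end

theorem theorem2p1 (j : ℕ) (hj : 1 ≤ j)
    (f : LpCirc (ENNReal.ofReal (specialExp j))) :
    -- `g = |f|^{p-1} sgn(f)` lies in `L^{2j}`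
    MemLp (dualFun (specialExp j) f) (evenExp j) circMeasure ∧
    -- the series defining `Φ_f` converges on the whole of `PD j`
    (∀ G ∈ PD j, Summable (phiTerm f G)) ∧
    -- existence and uniqueness of the maximizer
    (∃! G : LpCirc (evenExp j), IsMaximizer j (dualFun (specialExp j) f) f G) ∧
    -- the product formed from it
    (∀ G : LpCirc (evenExp j), IsMaximizer j (dualFun (specialExp j) f) f G →
      MemLp (powProd j G) (ENNReal.ofReal (specialExp j)) circMeasure ∧
      eLpNorm (powProd j G) (ENNReal.ofReal (specialExp j)) circMeasure =
        eLpNorm f (ENNReal.ofReal (specialExp j)) circMeasure ∧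
      Majorizes (powProd j G) f) := by
  have : Fact (1 ≤ j) := ⟨hj⟩
  refine ⟨memLp_dualFun f, fun G hG => summable_phiTerm f hG, existsUnique_isMaximizer f,
    fun G hG => ⟨⟨aestronglyMeasurable_powProd j (Lp.aestronglyMeasurable G), ?_⟩,
      hG.eLpNorm_powProd_eq, hG.majorizes⟩⟩
  rw [hG.eLpNorm_powProd_eq]
  exact Lp.eLpNorm_lt_top f
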